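/- Let $G$ be a finite simple connected graph with $n\ge 1$ vertices, vertex set $V$, and Laplacian matrix $L_G$. For a vertex $r$ let $L_G(r)\in\mathbb Z^{V\times(V\setminus\{r\})}$ be $L_G$ with the column of $r$ deleted, let $[L_G(r)\mid\mathbb 1]$ be this matrix with a column of ones appended, and let $P_{G,r}=\mathrm{conv}\{\text{rows of }L_G(r)\}\subset\mathbb R^{V\setminus\{r\}}$ be the Laplacian simplex of $G$ (for different $r$ these simplices are unimodularly equivalent; when $V=\{1,\dots,n\}$, $P_G=P_{G,n}$). Put $$\Pi(P_{G,r})=\{c\cdot[L_G(r)\mid\mathbb 1] : c\in[0,1)^V\},\qquad \Lambda(P_{G,r})=\{c\in[0,1)^V : c\cdot[L_G(r)\mid\mathbb 1]\text{ is an integer vector}\}.$$ A lattice polytope (the convex hull of finitely many integer points) is reflexive if it contains the origin in its interior and its dual $P^\vee=\{x : x\cdot y\le 1\ \text{for all } y\in P\}$ is a lattice polytope. The $h^*$-polynomial of a lattice polytope $P$ of dimension $d$ is the polynomial $h^*_P$ of degree at most $d$ with $1+\sum_{t\ge1}|tP\cap\mathbb Z^m|\,z^t=h^*_P(z)/(1-z)^{d+1}$,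 where $\mathbb Z^m$ is the lattice of the ambient space; $h^*(P)=(h^*_0,\dots,h^*_d)$ is its coefficient vector. A vector $(a_0,\dots,a_d)$ is unimodal if $a_0\le\dots\le a_j\ge\dots\ge a_d$ for some $0\le j\le d$. The whiskered graph $W(G)$ is obtained from $G$ by attaching to every vertex $v$ a new vertex $v'$ by a single edge $\{v,v'\}$. Suppose that $P_{G,r}$ is reflexive for a vertex $r$ of $G$, let $s$ be any vertex of $W(G)$, and let $L$ be the Laplacian matrix of $W(G)$. For $\lambda\in\mathbb R^V$ let $(\lambda,\lambda)$ be the vector with entry $\lambda_v$ at both $v$ and $v'$. Then: 1. The set of lattice points of $\Pi(P_{W(G),s})$ is exactly $$\Big\{(\lambda,\lambda)\cdot[L(s)\mid\mathbb 1],\ \ \big((\lambda,\lambda)+\tfrac1{2n}\mathbb 1\big)\cdot[L(s)\mid\mathbb 1]\ \Big|\ \lambda\in\Lambda(P_{G,r})\Big\}.$$ 2. The $h^*$-polynomials of $P_{G,r}$ and $P_{W(G),s}$ exist and satisfy $h^*_{P_{W(G),s}}(z)=(1+z)\,h^*_{P_{G,r}}(z^2)$. 3. $h^*(P_{W(G),s})$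 is unimodal if and only if $h^*(P_{G,r})$ is unimodal. -/

import Mathlib

namespace LaplacianSimplex

open scoped Pointwise Matrix PowerSeries Polynomial

/-! Lattice polytopes in the coordinate space `ι → ℝ` with lattice `ι → ℤ`. -/

/-- The lattice points of `ι → ℝ`: the vectors with integer entries. -/
def intPoints (ι : Type*) : Set (ι → ℝ) :=
  {x | ∀ i, ∃ m : ℤ, x i = (m : ℝ)}

/-- A lattice polytope: the convex hull of finitely many lattice points. -/
def IsLatticePolytope {ι : Type*} (P : Set (ι → ℝ)) : Prop :=
  ∃ S : Set (ι → ℝ), S.Finite ∧ S ⊆ intPoints ι ∧ P = convexHull ℝ S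

/-- The dual `{x | x · y ≤ 1 for all y ∈ P}`. -/
def dualPolytope {ι : Type*} [Fintype ι] (P : Set (ι → ℝ)) : Set (ι → ℝ) :=
  {x | ∀ y ∈ P, x ⬝ᵥ y ≤ 1}

/-- A lattice polytope is reflexive if it contains the origin in its interior and its dual is
a lattice polytope. -/
def IsReflexive {ι : Type*} [Fintype ι] (P : Set (ι → ℝ)) : Prop :=
  IsLatticePolytope P ∧ (0 : ι → ℝ) ∈ interior P ∧ IsLatticePolytope (dualPolytope P)

/-- The dimension of (the affine hull of) `P`. -/
noncomputable def polyDim {ι : Type*} (P : Set (ι → ℝ)) : ℕ :=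
  Module.finrank ℝ (vectorSpan ℝ P)

/-- The number of lattice points in the `t`-th dilate of `P`. -/
noncomputable def latticeCount {ι : Type*} (P : Set (ι → ℝ)) (t : ℕ) : ℕ :=
  (((t : ℝ) • P) ∩ intPoints ι).ncard

/-- The Ehrhart series `1 + ∑_{t ≥ 1} L_P(t) z^t`. -/
noncomputable def ehrhartSeries {ι : Type*} (P : Set (ι → ℝ)) : ℤ⟦X⟧ :=
  PowerSeries.mk fun t => if t = 0 then 1 else (latticeCount P t : ℤ)

/-- `h` is the `h^*`-polynomial of `P`: its degree is at most `d = dim P`, and the Ehrhart series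
of `P` is `h(z) / (1 - z)^(d+1)`. -/
def IsHStarPolynomial {ι : Type*} (P : Set (ι → ℝ)) (h : ℤ[X]) : Prop :=
  h.natDegree ≤ polyDim P ∧
    ehrhartSeries P * (1 - PowerSeries.X) ^ (polyDim P + 1) = (h : ℤ⟦X⟧)

/-- A set has at most one `h^*`-polynomial. -/
theorem IsHStarPolynomial.unique {ι : Type*} {P : Set (ι → ℝ)} {h h' : ℤ[X]}
    (H : IsHStarPolynomial P h) (H' : IsHStarPolynomial P h') : h = h' :=
  Polynomial.coe_injective ℤ (H.2.symm.trans H'.2)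

/-- The vector `(a 0, …, a d)` is unimodal. -/
def IsUnimodal (d : ℕ) (a : ℕ → ℤ) : Prop :=
  ∃ j ≤ d, (∀ i < j, a i ≤ a (i + 1)) ∧ ∀ k, j ≤ k → k < d → a (k + 1) ≤ a k

/-! Polytopes given by an integer vertex matrix, whose rows are the vertices. -/

/-- The convex hull of the rows of `M`. -/
def rowHull {κ ι : Type*} (M : Matrix κ ι ℤ) : Set (ι → ℝ) :=
  convexHull ℝ (Set.range fun k i => (M k i : ℝ))

/-- The matrix `[M | 𝟙]`, with real entries. The appended column has index `Sum.inr ()`. -/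
def appendOne {κ ι : Type*} (M : Matrix κ ι ℤ) : Matrix κ (ι ⊕ Unit) ℝ :=
  Matrix.fromCols (M.map (Int.cast : ℤ → ℝ)) (Matrix.of fun _ _ => 1)

/-- The fundamental parallelepiped `Π`: all `∑ k, c k • (v_k, 1)` with `0 ≤ c k < 1`. -/
def fundPar {κ ι : Type*} [Fintype κ] (M : Matrix κ ι ℤ) : Set (ι ⊕ Unit → ℝ) :=
  {x | ∃ c : κ → ℝ, (∀ k, 0 ≤ c k ∧ c k < 1) ∧ x = c ᵥ* appendOne M}

/-- The set `Λ` of coefficient vectors of the lattice points of the fundamental parallelepiped. -/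
def parCoeffs {κ ι : Type*} [Fintype κ] (M : Matrix κ ι ℤ) : Set (κ → ℝ) :=
  {c | (∀ k, 0 ≤ c k ∧ c k < 1) ∧ c ᵥ* appendOne M ∈ intPoints (ι ⊕ Unit)}

/-! Laplacian simplices and whiskering. -/

/-- `L_G(r)`: the Laplacian matrix of `G` with the column of the vertex `r` deleted. -/
def lapDelete {V : Type*} [Fintype V] [DecidableEq V] (G : SimpleGraph V) [DecidableRel G.Adj]
    (r : V) : Matrix V {w : V // w ≠ r} ℤ :=
  (G.lapMatrix ℤ).submatrix id Subtype.val

/-- The Laplacian simplex `P_{G,r}`: the convex hull of the rows of `L_G(r)`. -/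
def lapSimplex {V : Type*} [Fintype V] [DecidableEq V] (G : SimpleGraph V) [DecidableRel G.Adj]
    (r : V) : Set ({w : V // w ≠ r} → ℝ) :=
  rowHull (lapDelete G r)

/-- Adjacency in the whiskered graph: the edges of `G` on the first copy of `V`, and an edge from
each `Sum.inl v` to the new vertex `Sum.inr v`. -/
def whiskerAdj {V : Type*} (G : SimpleGraph V) : V ⊕ V → V ⊕ V → Prop
  | Sum.inl a, Sum.inl b => G.Adj a b
  | Sum.inl a, Sum.inr b => a = b
  | Sum.inr a, Sum.inl b => a = b
  | Sum.inr _, Sum.inr _ => False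

/-- The whiskered graph `W(G)`. -/
def whisker {V : Type*} (G : SimpleGraph V) : SimpleGraph (V ⊕ V) where
  Adj := whiskerAdj G
  symm := ⟨by
    rintro (a | a) (b | b) h
    · exact SimpleGraph.Adj.symm (G := G) h
    · exact Eq.symm h
    · exact Eq.symm h
    · exact h⟩
  loopless := ⟨by
    rintro (a | a) h
    · exact SimpleGraph.irrefl G h
    · exact h⟩

instance whiskerDecidable {V : Type*} [DecidableEq V] (G : SimpleGraph V) [DecidableRel G.Adj] :
    DecidableRel (whisker G).Adj
  | Sum.inl a, Sum.inl b => inferInstanceAs (Decidable (G.Adj a b))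
  | Sum.inl a, Sum.inr b => inferInstanceAs (Decidable (a = b))
  | Sum.inr a, Sum.inl b => inferInstanceAs (Decidable (a = b))
  | Sum.inr _, Sum.inr _ => inferInstanceAs (Decidable False)

end LaplacianSimplex

open LaplacianSimplex
open scoped Matrix Polynomial

/-! The `h^*`-polynomial of a lattice simplex counts the lattice points of its half-open fundamental
parallelepiped by height, the height being the sum of the coefficients
(`isHStarPolynomial_rowHull`). Everything therefore reduces to finding the coefficient vectors `c`
for `W(G)`.

Integrality at a whisker `v'` says that `c v' - c v` is an integer; both values lie in `[0,1)`, so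
they agree (`mem_parCoeffs_whisker_iff`). Hence `c = (a, a)` with `L_G a` integral, and the height
condition only asks that `∑ a` be a half-integer or an integer.

Reflexivity provides, for each `v`, an integer vector pairing to `1` with every row except that of
`v`, where it gives `1 - n` (`exists_integral_dual_vertex`). Pairing it with `L_G a` yields `n * a v
≡ ∑ a` modulo `1`. If `∑ a` is an integer, then `a ∈ Λ`. Otherwise every `n * a v` lies in `1/2 +
ℤ`, so `a v ≥ 1/(2n)` and subtracting `1/(2n)` lands in `Λ`. Conversely, `n * λ v` is an integer
below `n` for `λ ∈ Λ`, which leaves room to add `1/(2n)` (`parCoeffs_whisker`).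

A point of height `h` thus produces one of height `2h` and one of height `2h + 1`. This is the
factor `(1 + z)` with `z ↦ z^2`: each coefficient is repeated twice, which preserves and reflects
unimodality. -/

namespace LaplacianSimplex

open scoped Pointwise PowerSeries

/-! ### Ehrhart theory of lattice simplices -/

section Simplex

variable {κ ι : Type*} [Fintype κ] (M : Matrix κ ι ℤ)

theorem vecMul_appendOne_inl (c : κ → ℝ) (i : ι) :
    (c ᵥ* appendOne M) (Sum.inl i) = ∑ k, c k * (M k i : ℝ) := by
  simp [appendOne, Matrix.vecMul, dotProduct]

theorem vecMul_appendOne_inr (c : κ → ℝ) (u : Unit) :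
    (c ᵥ* appendOne M) (Sum.inr u) = ∑ k, c k := by
  simp [appendOne, Matrix.vecMul, dotProduct]

theorem vecMul_appendOne_mem_intPoints_iff (c : κ → ℝ) :
    c ᵥ* appendOne M ∈ intPoints (ι ⊕ Unit) ↔
      (∀ i, ∃ m : ℤ, ∑ k, c k * (M k i : ℝ) = m) ∧ ∃ m : ℤ, ∑ k, c k = m := by
  simp only [intPoints, Set.mem_ofPred_eq, Sum.forall, vecMul_appendOne_inl, vecMul_appendOne_inr]
  exact and_congr_right fun _ => ⟨fun h => h (), fun h _ => h⟩

theorem fundPar_inter_intPoints :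
    fundPar M ∩ intPoints (ι ⊕ Unit) = (fun c => c ᵥ* appendOne M) '' parCoeffs M := by
  ext x
  constructor
  · rintro ⟨⟨c, hc, rfl⟩, hx⟩
    exact ⟨c, ⟨hc, hx⟩, rfl⟩
  · rintro ⟨c, ⟨hc, hx⟩, rfl⟩
    exact ⟨⟨c, hc, rfl⟩, hx⟩

/-- The coefficient vectors of the lattice points of the fundamental parallelepiped are finitely
many when the rows of `[M | 𝟙]` are linearly independent. -/
theorem finite_parCoeffs [Finite ι]
    (hM : Function.Injective fun c : κ → ℝ => c ᵥ* appendOne M) : (parCoeffs M).Finite := by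
  set A := appendOne M
  have hfin : {x : ι ⊕ Unit → ℝ | ∀ j, x j ∈ (Int.cast : ℤ → ℝ) ''
      Set.Icc (-⌈∑ k, |A k j|⌉) ⌈∑ k, |A k j|⌉}.Finite :=
    Set.Finite.pi' fun j => (Set.finite_Icc _ _).image _
  refine Set.Finite.of_finite_image (f := fun c => c ᵥ* A) (hfin.subset ?_) hM.injOn
  rintro _ ⟨c, ⟨hc, hx⟩, rfl⟩ j
  obtain ⟨m, hm⟩ := hx j
  have hb : |(m : ℝ)| ≤ ∑ k, |A k j| := by
    rw [← hm]
    refine (Finset.abs_sum_le_sum_abs _ _).trans (Finset.sum_le_sum fun k _ => ?_)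
    rw [abs_mul, abs_of_nonneg (hc k).1]
    exact mul_le_of_le_one_left (abs_nonneg _) (hc k).2.le
  have hb' : |(m : ℝ)| ≤ (⌈∑ k, |A k j|⌉ : ℝ) := hb.trans (Int.le_ceil _)
  rw [abs_le] at hb'
  exact ⟨m, ⟨by exact_mod_cast hb'.1, by exact_mod_cast hb'.2⟩, hm.symm⟩

theorem mem_smul_rowHull_iff [Nonempty κ] (t : ℕ) (x : ι → ℝ) :
    x ∈ (t : ℝ) • rowHull M ↔
      ∃ c : κ → ℝ, (∀ k, 0 ≤ c k) ∧ ∑ k, c k = t ∧ ∀ i, x i = ∑ k, c k * (M k i : ℝ) := by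
  classical
  have hull : ∀ y, y ∈ rowHull M ↔
      ∃ c : κ → ℝ, (∀ k, 0 ≤ c k) ∧ ∑ k, c k = 1 ∧ ∀ i, y i = ∑ k, c k * (M k i : ℝ) := by
    intro y
    constructor
    · intro hy
      rw [rowHull, ← Set.image_univ] at hy
      let f : (κ → ℝ) →ₗ[ℝ] (ι → ℝ) := Matrix.vecMulLinear (M.map (Int.cast : ℤ → ℝ))
      have : (fun k i => (M k i : ℝ)) '' Set.univ =
          f '' Set.range fun k : κ => Pi.single k (1 : ℝ) := by
        rw [Set.image_univ, ← Set.range_comp]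
        congr 1
        ext k i
        simp [f]
      rw [this, ← LinearMap.image_convexHull, convexHull_rangle_single_eq_stdSimplex] at hy
      obtain ⟨c, hc, rfl⟩ := hy
      exact ⟨c, hc.1, hc.2, fun i => by simp [f, Matrix.vecMul, dotProduct]⟩
    · rintro ⟨c, hc, hs, hy⟩
      refine mem_convexHull_of_exists_fintype c (fun k i => (M k i : ℝ)) hc hs
        (fun k => Set.mem_range_self k) ?_
      ext i
      simp [hy i]
  rw [Set.mem_smul_set]
  constructor
  · rintro ⟨y, hy, rfl⟩
    obtain ⟨c, hc, hs, hy⟩ := (hull y).1 hy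
    refine ⟨fun k => t * c k, fun k => mul_nonneg t.cast_nonneg (hc k), ?_, fun i => ?_⟩
    · rw [← Finset.mul_sum, hs, mul_one]
    · simp [hy, Finset.mul_sum, mul_assoc]
  · rintro ⟨c, hc, hs, hx⟩
    -- For `t = 0` one cannot rescale by `t⁻¹`; the point is `0`, and any vertex serves as the point
    -- being scaled.
    rcases Nat.eq_zero_or_pos t with rfl | ht
    · have hc0 : ∀ k, c k = 0 := fun k =>
        (Finset.sum_eq_zero_iff_of_nonneg fun k _ => hc k).1 (by simpa using hs) k
          (Finset.mem_univ k)
      obtain ⟨k⟩ := ‹Nonempty κ›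
      refine ⟨fun i => (M k i : ℝ), subset_convexHull _ _ ⟨k, rfl⟩, ?_⟩
      ext i
      simp [hx, hc0]
    · have ht' : (t : ℝ) ≠ 0 := by positivity
      refine ⟨(t : ℝ)⁻¹ • x, (hull _).2 ⟨fun k => (t : ℝ)⁻¹ * c k,
        fun k => mul_nonneg (by positivity) (hc k), ?_, fun i => ?_⟩, ?_⟩
      · rw [← Finset.mul_sum, hs, inv_mul_cancel₀ ht']
      · simp [hx, Finset.mul_sum, mul_assoc]
      · rw [smul_smul, mul_inv_cancel₀ ht', one_smul]

theorem polyDim_rowHull_add_one [Nonempty κ]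
    (hM : Function.Injective fun c : κ → ℝ => c ᵥ* appendOne M) :
    polyDim (rowHull M) + 1 = Fintype.card κ := by
  have hind : AffineIndependent ℝ fun (k : κ) (i : ι) => (M k i : ℝ) := by
    rw [affineIndependent_iff_of_fintype]
    intro w hw hv
    rw [Finset.weightedVSub_eq_linear_combination _ hw] at hv
    refine congrFun (@hM w 0 ?_)
    ext (i | u)
    · simpa [vecMul_appendOne_inl] using congrFun hv i
    · simpa [vecMul_appendOne_inr] using hw
  rw [← hind.finrank_vectorSpan_add_one, polyDim, rowHull, ← direction_affineSpan,
    affineSpan_convexHull, direction_affineSpan]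

/-- The sum of `X ^ ∑ k, c k` over the coefficient vectors `c` of the lattice points of the
fundamental parallelepiped. -/
noncomputable def parPolynomial : ℤ[X] :=
  ∑ᶠ c ∈ parCoeffs M, Polynomial.X ^ ⌊∑ k, c k⌋₊

variable {M}

theorem sum_eq_floor_of_mem_parCoeffs {c : κ → ℝ} (hc : c ∈ parCoeffs M) :
    ∑ k, c k = (⌊∑ k, c k⌋₊ : ℝ) := by
  obtain ⟨m, hm⟩ := ((vecMul_appendOne_mem_intPoints_iff M c).1 hc.2).2
  have h0 : 0 ≤ ∑ k, c k := Finset.sum_nonneg fun k _ => (hc.1 k).1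
  lift m to ℕ using by
    rw [hm] at h0
    exact_mod_cast h0
  simp [hm]

theorem natDegree_parPolynomial_lt [Nonempty κ] :
    (parPolynomial M).natDegree < Fintype.card κ := by
  have hlt : ∀ c ∈ parCoeffs M, ⌊∑ k, c k⌋₊ < Fintype.card κ := by
    intro c hc
    have : ∑ k, c k < ∑ _k : κ, (1 : ℝ) :=
      Finset.sum_lt_sum_of_nonempty Finset.univ_nonempty fun k _ => (hc.1 k).2
    rw [sum_eq_floor_of_mem_parCoeffs hc] at this
    simpa using this
  have hpos : 0 < Fintype.card κ := Fintype.card_pos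
  refine finsum_mem_induction (fun p : ℤ[X] => p.natDegree < Fintype.card κ) (by simpa)
    (fun p q hp hq => (Polynomial.natDegree_add_le p q).trans_lt (max_lt hp hq)) fun c hc => ?_
  simpa using hlt c hc

/-- Expanding a power of the geometric series: each factor contributes one exponent. -/
theorem coeff_mk_one_pow_card [DecidableEq κ] (t : ℕ) :
    PowerSeries.coeff t ((PowerSeries.mk (1 : ℕ → ℤ)) ^ Fintype.card κ) =
      ((Finset.univ : Finset κ).finsuppAntidiag t).card := by
  rw [← Finset.card_univ, ← Finset.prod_const, PowerSeries.coeff_prod]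
  simp

/-- Lattice points of a dilated simplex correspond to pairs of a lattice point of the fundamental
parallelepiped and a vector of natural numbers. -/
theorem latticeCount_rowHull [Nonempty κ] [DecidableEq κ]
    (hM : Function.Injective fun c : κ → ℝ => c ᵥ* appendOne M)
    (hfin : (parCoeffs M).Finite) (t : ℕ) :
    latticeCount (rowHull M) t = ∑ c ∈ hfin.toFinset,
      if ⌊∑ k, c k⌋₊ ≤ t then
        ((Finset.univ : Finset κ).finsuppAntidiag (t - ⌊∑ k, c k⌋₊)).card else 0 := by
  classical
  -- Splitting barycentric coefficients into fractional parts and floors gives the pair; the floors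
  -- sum to `t` minus the height of the fractional part.
  have key : ((t : ℝ) • rowHull M) ∩ intPoints ι =
      (fun p : Σ _ : κ → ℝ, κ →₀ ℕ => fun i => ∑ k, (p.1 k + p.2 k) * (M k i : ℝ)) ''
      (hfin.toFinset.sigma fun c => if ⌊∑ k, c k⌋₊ ≤ t then
        (Finset.univ : Finset κ).finsuppAntidiag (t - ⌊∑ k, c k⌋₊) else ∅ :
          Finset (Σ _ : κ → ℝ, κ →₀ ℕ)) := by
    ext x
    simp only [Set.mem_inter_iff, mem_smul_rowHull_iff, Set.mem_image, Finset.mem_coe,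
      Finset.mem_sigma, Set.Finite.mem_toFinset]
    constructor
    · rintro ⟨⟨c, hc, hs, hx⟩, hint⟩
      have hsum : ∑ k, Int.fract (c k) + ((∑ k, ⌊c k⌋₊ : ℕ) : ℝ) = t := by
        rw [← hs]
        push_cast
        rw [← Finset.sum_add_distrib]
        exact Finset.sum_congr rfl fun k _ => by
          rw [natCast_floor_eq_intCast_floor (hc k), Int.fract_add_floor]
      have hmem : (fun k => Int.fract (c k)) ∈ parCoeffs M := by
        refine ⟨fun k => ⟨Int.fract_nonneg _, Int.fract_lt_one _⟩,
          (vecMul_appendOne_mem_intPoints_iff M _).2 ⟨fun i => ?_, ?_⟩⟩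
        · obtain ⟨m, hm⟩ := hint i
          refine ⟨m - ∑ k, ⌊c k⌋ * M k i, ?_⟩
          push_cast
          rw [← hm, hx, ← Finset.sum_sub_distrib]
          exact Finset.sum_congr rfl fun k _ => by rw [Int.fract]; ring
        · refine ⟨t - (∑ k, ⌊c k⌋₊ : ℕ), ?_⟩
          rw [Int.cast_sub, Int.cast_natCast, Int.cast_natCast, ← hsum]
          ring
      refine ⟨⟨fun k => Int.fract (c k), Finsupp.equivFunOnFinite.symm fun k => ⌊c k⌋₊⟩,
        ⟨hmem, ?_⟩, ?_⟩
      · have h1 := sum_eq_floor_of_mem_parCoeffs hmem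
        simp only at h1 ⊢
        rw [h1] at hsum
        norm_cast at hsum
        rw [if_pos (by omega)]
        simp only [Finset.mem_finsuppAntidiag, Finsupp.coe_equivFunOnFinite_symm,
          Finset.subset_univ, and_true]
        have : Finset.univ.sum (fun k => ⌊c k⌋₊) = ∑ k, ⌊c k⌋₊ := rfl
        omega
      · ext i
        rw [hx]
        refine Finset.sum_congr rfl fun k _ => ?_
        simp [natCast_floor_eq_intCast_floor (hc k)]
    · rintro ⟨⟨c, f⟩, ⟨hc, hf⟩, rfl⟩
      simp only at hc hf ⊢
      split_ifs at hf with hle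
      · have hf' : ∑ k, f k = t - ⌊∑ k, c k⌋₊ := (Finset.mem_finsuppAntidiag.1 hf).1
        refine ⟨⟨fun k => c k + f k, fun k => add_nonneg (hc.1 k).1 (f k).cast_nonneg, ?_,
          fun i => rfl⟩, fun i => ?_⟩
        · rw [Finset.sum_add_distrib, sum_eq_floor_of_mem_parCoeffs hc, ← Nat.cast_sum, hf',
            Nat.cast_sub hle]
          ring
        · obtain ⟨m, hm⟩ := ((vecMul_appendOne_mem_intPoints_iff M c).1 hc.2).1 i
          refine ⟨m + ∑ k, f k * M k i, ?_⟩
          simp [add_mul, Finset.sum_add_distrib, hm]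
      · simp at hf
  rw [latticeCount, key, Set.InjOn.ncard_image, Set.ncard_coe_finset, Finset.card_sigma]
  · exact Finset.sum_congr rfl fun c _ => by split_ifs <;> simp
  · rintro ⟨c, f⟩ hcf ⟨d, g⟩ hdg h
    simp only [Finset.mem_coe, Finset.mem_sigma, Set.Finite.mem_toFinset] at hcf hdg
    obtain ⟨hc, hf⟩ := hcf
    obtain ⟨hd, hg⟩ := hdg
    have total : ∀ (c : κ → ℝ) (f : κ →₀ ℕ), c ∈ parCoeffs M →
        (f ∈ if ⌊∑ k, c k⌋₊ ≤ t then
          (Finset.univ : Finset κ).finsuppAntidiag (t - ⌊∑ k, c k⌋₊) else ∅) →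
        ∑ k, (c k + f k) = t := by
      intro c f hc hf
      split_ifs at hf with hle
      · have hf' : ∑ k, f k = t - ⌊∑ k, c k⌋₊ := (Finset.mem_finsuppAntidiag.1 hf).1
        rw [Finset.sum_add_distrib, sum_eq_floor_of_mem_parCoeffs hc, ← Nat.cast_sum, hf',
          Nat.cast_sub hle]
        ring
      · simp at hf
    -- Both coefficient sums equal `t`, so the appended coordinate agrees too and `hM` applies.
    have heq : (fun k => c k + (f k : ℝ)) = fun k => d k + (g k : ℝ) := by
      apply hM
      ext (i | u)
      · simpa only [vecMul_appendOne_inl] using congrFun h i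
      · simp only [vecMul_appendOne_inr]
        rw [total c f hc hf, total d g hd hg]
    have hfg : f = g := by
      ext k
      have h1 : c k + (f k : ℝ) = d k + g k := congrFun heq k
      have h2 := hc.1 k
      have h3 := hd.1 k
      have h4 : (f k : ℝ) < g k + 1 := by linarith
      have h5 : (g k : ℝ) < f k + 1 := by linarith
      norm_cast at h4 h5
      omega
    subst hfg
    have hcd : c = d := by
      ext k
      simpa using congrFun heq k
    rw [hcd]

/-- The `h^*`-polynomial of a lattice simplex. -/
theorem isHStarPolynomial_rowHull [Nonempty κ] [Finite ι]
    (hM : Function.Injective fun c : κ → ℝ => c ᵥ* appendOne M) :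
    IsHStarPolynomial (rowHull M) (parPolynomial M) := by
  classical
  have hfin := finite_parCoeffs M hM
  have hdim := polyDim_rowHull_add_one M hM
  refine ⟨by have := natDegree_parPolynomial_lt (M := M); omega, ?_⟩
  have hser : ehrhartSeries (rowHull M) =
      (parPolynomial M : ℤ⟦X⟧) * (PowerSeries.mk (1 : ℕ → ℤ)) ^ Fintype.card κ := by
    ext t
    have hcount : PowerSeries.coeff t
        ((parPolynomial M : ℤ⟦X⟧) * (PowerSeries.mk (1 : ℕ → ℤ)) ^ Fintype.card κ) =
        latticeCount (rowHull M) t := by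
      rw [latticeCount_rowHull hM hfin, parPolynomial,
        finsum_mem_eq_finite_toFinset_sum _ hfin, ← Polynomial.coeToPowerSeries.ringHom_apply,
        map_sum, Finset.sum_mul, map_sum, Nat.cast_sum]
      refine Finset.sum_congr rfl fun c _ => ?_
      rw [map_pow, Polynomial.coeToPowerSeries.ringHom_apply, Polynomial.coe_X,
        PowerSeries.coeff_X_pow_mul', coeff_mk_one_pow_card]
      split_ifs <;> simp
    rw [hcount, ehrhartSeries, PowerSeries.coeff_mk]
    -- The constant term `1` set by convention is also the actual count, since `0 • P = {0}`.
    split_ifs with ht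
    · subst ht
      have : ((0 : ℕ) : ℝ) • rowHull M ∩ intPoints ι = {0} := by
        obtain ⟨k⟩ := ‹Nonempty κ›
        have hne : (rowHull M).Nonempty := ⟨_, subset_convexHull _ _ ⟨k, rfl⟩⟩
        rw [Nat.cast_zero, Set.zero_smul_set hne, ← Set.singleton_zero]
        exact Set.inter_eq_left.2 (Set.singleton_subset_iff.2 fun i => ⟨0, by simp⟩)
      rw [latticeCount, this, Set.ncard_singleton]
      rfl
    · rfl
  rw [hser, hdim, mul_assoc, ← mul_pow, PowerSeries.mk_one_mul_one_sub_eq_one, one_pow, mul_one]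

end Simplex

/-! ### Laplacian simplices and the integrality forced by reflexivity -/

section Laplacian

variable {V : Type*} [Fintype V] [DecidableEq V] (G : SimpleGraph V) [DecidableRel G.Adj]

theorem lapMatrix_mulVec_eq_sum (c : V → ℝ) (w : V) :
    (G.lapMatrix ℝ *ᵥ c) w = ∑ u, if G.Adj w u then c w - c u else 0 := by
  rw [SimpleGraph.lapMatrix_mulVec_apply, SimpleGraph.degree_eq_sum_if_adj, Finset.sum_mul,
    SimpleGraph.neighborFinset_eq_filter, Finset.sum_filter, ← Finset.sum_sub_distrib]
  exact Finset.sum_congr rfl fun u _ => by split_ifs <;> simp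

theorem sum_mul_lapMatrix_int (c : V → ℝ) (w : V) :
    ∑ v, c v * (G.lapMatrix ℤ v w : ℝ) = (G.lapMatrix ℝ *ᵥ c) w := by
  rw [Matrix.mulVec, dotProduct]
  refine Finset.sum_congr rfl fun v _ => ?_
  rw [mul_comm, ← (G.isSymm_lapMatrix (R := ℝ)).apply]
  simp [SimpleGraph.lapMatrix, SimpleGraph.degMatrix, Matrix.diagonal_apply,
    SimpleGraph.adjMatrix_apply, apply_ite (Int.cast : ℤ → ℝ)]

theorem sum_lapMatrix_mulVec (c : V → ℝ) : ∑ w, (G.lapMatrix ℝ *ᵥ c) w = 0 := by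
  have h := Matrix.dotProduct_mulVec (fun _ => (1 : ℝ)) (G.lapMatrix ℝ) c
  rw [← Matrix.mulVec_transpose, (G.isSymm_lapMatrix (R := ℝ)).eq,
    G.lapMatrix_mulVec_const_eq_zero, zero_dotProduct] at h
  simpa [dotProduct] using h

theorem vecMul_lapDelete_inl (r : V) (c : V → ℝ) (i : {w : V // w ≠ r}) :
    (c ᵥ* appendOne (lapDelete G r)) (Sum.inl i) = (G.lapMatrix ℝ *ᵥ c) i := by
  rw [vecMul_appendOne_inl, ← sum_mul_lapMatrix_int]
  rfl

/-- Deleting the column of `r` loses nothing: integrality or vanishing of the other entries passes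
to the entry at `r`. -/
theorem lapMatrix_mulVec_eq_neg_sum (r : V) (c : V → ℝ) :
    (G.lapMatrix ℝ *ᵥ c) r = -∑ i : {w : V // w ≠ r}, (G.lapMatrix ℝ *ᵥ c) i := by
  have h := sum_lapMatrix_mulVec G c
  rw [← Fintype.sum_subtype_add_sum_subtype (· ≠ r)] at h
  have : ∑ i : {w : V // ¬w ≠ r}, (G.lapMatrix ℝ *ᵥ c) i = (G.lapMatrix ℝ *ᵥ c) r := by
    have e : ∀ i : {w : V // ¬w ≠ r}, (G.lapMatrix ℝ *ᵥ c) i = (G.lapMatrix ℝ *ᵥ c) r :=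
      fun i => by rw [not_not.1 i.2]
    simp [e]
  linarith

theorem mem_parCoeffs_lapDelete_iff (r : V) (c : V → ℝ) :
    c ∈ parCoeffs (lapDelete G r) ↔ (∀ v, 0 ≤ c v ∧ c v < 1) ∧
      (∀ w, ∃ m : ℤ, (G.lapMatrix ℝ *ᵥ c) w = m) ∧ ∃ m : ℤ, ∑ v, c v = m := by
  refine and_congr_right fun _ => ?_
  rw [vecMul_appendOne_mem_intPoints_iff]
  refine and_congr_left fun _ => ?_
  simp only [← vecMul_appendOne_inl, vecMul_lapDelete_inl]
  refine ⟨fun h w => ?_, fun h i => h i⟩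
  by_cases hw : w = r
  · choose m hm using h
    refine ⟨-∑ i, m i, ?_⟩
    rw [hw, lapMatrix_mulVec_eq_neg_sum]
    simp [hm]
  · exact h ⟨w, hw⟩

theorem injective_vecMul_lapDelete (r : V)
    (h : ∀ c : V → ℝ, G.lapMatrix ℝ *ᵥ c = 0 → ∑ v, c v = 0 → c = 0) :
    Function.Injective fun c : V → ℝ => c ᵥ* appendOne (lapDelete G r) := by
  intro c d hcd
  have hz : (c - d) ᵥ* appendOne (lapDelete G r) = 0 := by
    rw [Matrix.sub_vecMul, sub_eq_zero]
    exact hcd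
  have hi : ∀ i : {w : V // w ≠ r}, (G.lapMatrix ℝ *ᵥ (c - d)) i = 0 := fun i => by
    rw [← vecMul_lapDelete_inl G r, hz, Pi.zero_apply]
  refine sub_eq_zero.1 (h (c - d) ?_ ?_)
  · ext w
    by_cases hw : w = r
    · rw [hw, lapMatrix_mulVec_eq_neg_sum]
      simp [hi]
    · exact hi ⟨w, hw⟩
  · rw [← vecMul_appendOne_inr (lapDelete G r) (c - d) (), hz, Pi.zero_apply]

variable {G}

theorem eq_zero_of_lapMatrix_mulVec_eq_zero (hG : G.Connected) {c : V → ℝ}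
    (hc : G.lapMatrix ℝ *ᵥ c = 0) (hs : ∑ v, c v = 0) : c = 0 := by
  have hconst := (SimpleGraph.lapMatrix_mulVec_eq_zero_iff_forall_reachable G).1 hc
  ext v
  have : ∑ w, c w = Fintype.card V * c v := by
    rw [Finset.sum_congr rfl fun w _ => hconst w v (hG.preconnected w v)]
    simp
  have hn : (Fintype.card V : ℝ) ≠ 0 := by
    have := Fintype.card_pos_iff.2 ⟨v⟩
    positivity
  simpa [hn] using this.symm.trans hs

variable (G) in
theorem sum_lapDelete_row_eq_zero (r : V) (i : {w : V // w ≠ r}) :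
    ∑ v, (lapDelete G r v i : ℝ) = 0 := by
  have h := sum_mul_lapMatrix_int G (fun _ => 1) i
  rw [G.lapMatrix_mulVec_const_eq_zero] at h
  simpa [lapDelete] using h

/-- The vertex of the dual polytope of a Laplacian simplex that corresponds to the facet
opposite to the row of `v`. -/
theorem exists_dual_vertex (hG : G.Connected) (r v : V) :
    ∃ u : {w : V // w ≠ r} → ℝ, ∀ w, u ⬝ᵥ (fun i => (lapDelete G r w i : ℝ)) =
      1 - if w = v then (Fintype.card V : ℝ) else 0 := by
  have hinj := injective_vecMul_lapDelete G r
    fun c hc hs => eq_zero_of_lapMatrix_mulVec_eq_zero hG hc hs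
  have hrank := (Matrix.vecMul_injective_iff.1 hinj).rank_matrix
  -- Linearly independent rows give full row rank, so every right-hand side is attained.
  have hsurj : Function.Surjective (appendOne (lapDelete G r)).mulVecLin := by
    rw [← LinearMap.range_eq_top]
    refine Submodule.eq_top_of_finrank_eq ?_
    rw [Module.finrank_pi]
    exact hrank
  obtain ⟨x, hx⟩ := hsurj fun w => 1 - if w = v then (Fintype.card V : ℝ) else 0
  have hx' : ∀ w, (∑ i, (lapDelete G r w i : ℝ) * x (Sum.inl i)) + x (Sum.inr ()) =
      1 - if w = v then (Fintype.card V : ℝ) else 0 := fun w => by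
    rw [← congrFun hx w]
    simp [appendOne, Matrix.mulVec, dotProduct]
  have hn : (Fintype.card V : ℝ) ≠ 0 := by
    have := Fintype.card_pos_iff.2 ⟨v⟩
    positivity
  -- Summing the equations over `w`, the columns of the Laplacian cancel and the right side is `n -
  -- n`, leaving `n * x (Sum.inr ()) = 0`.
  have hlast : x (Sum.inr ()) = 0 := by
    have h := Finset.sum_congr (rfl : (Finset.univ : Finset V) = _) fun w _ => hx' w
    rw [Finset.sum_add_distrib, Finset.sum_comm, Finset.sum_sub_distrib] at h
    simp only [← Finset.sum_mul, sum_lapDelete_row_eq_zero] at h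
    simpa [hn] using h
  refine ⟨fun i => x (Sum.inl i), fun w => ?_⟩
  rw [← hx' w, hlast, add_zero, dotProduct]
  exact Finset.sum_congr rfl fun i _ => mul_comm _ _

/-- The real solution lies in the dual, hence is a convex combination of lattice points of the dual.
Any of these with positive weight must attain equality wherever the combination does, so it is an
integral solution. -/
theorem exists_integral_dual_vertex (hG : G.Connected) {r : V}
    (hrefl : IsReflexive (lapSimplex G r)) (v : V) :
    ∃ u : {w : V // w ≠ r} → ℤ, ∀ w, ∑ i, u i * lapDelete G r w i =
      1 - if w = v then (Fintype.card V : ℤ) else 0 := by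
  obtain ⟨u, hu⟩ := exists_dual_vertex hG r v
  obtain ⟨S, -, hS, hdual⟩ := hrefl.2.2
  have hmem : u ∈ dualPolytope (lapSimplex G r) := by
    have hconv : Convex ℝ {y : {w : V // w ≠ r} → ℝ | u ⬝ᵥ y ≤ 1} :=
      convex_halfSpace_le (LinearMap.isLinear (dotProductBilin ℝ ℝ u)) 1
    refine fun y hy => convexHull_min ?_ hconv hy
    rintro _ ⟨w, rfl⟩
    simp only [Set.mem_ofPred_eq, hu]
    split_ifs <;> simp
  rw [hdual, mem_convexHull_iff_exists_fintype] at hmem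
  obtain ⟨α, _, p, z, hp, hps, hz, hpz⟩ := hmem
  obtain ⟨a, ha⟩ : ∃ a, 0 < p a := by
    by_contra! hneg
    have := Finset.sum_nonpos fun a (_ : a ∈ Finset.univ) => hneg a
    linarith
  have hle : ∀ b w, z b ⬝ᵥ (fun i => (lapDelete G r w i : ℝ)) ≤ 1 := fun b w =>
    (hdual ▸ subset_convexHull ℝ S (hz b) : z b ∈ dualPolytope (lapSimplex G r)) _
      (subset_convexHull _ _ ⟨w, rfl⟩)
  have heq : ∀ w, w ≠ v → z a ⬝ᵥ (fun i => (lapDelete G r w i : ℝ)) = 1 := by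
    intro w hw
    -- A weighted sum of nonnegative slacks that vanishes, so the slack of `z a` is zero.
    have h0 : ∑ b, p b * (1 - z b ⬝ᵥ fun i => (lapDelete G r w i : ℝ)) = 0 := by
      have h1 := hu w
      rw [← hpz, sum_dotProduct] at h1
      simp only [smul_dotProduct, smul_eq_mul, if_neg hw, sub_zero] at h1
      simp only [mul_sub, mul_one, Finset.sum_sub_distrib, hps, h1, sub_self]
    have h2 := (Finset.sum_eq_zero_iff_of_nonneg fun b _ =>
      mul_nonneg (hp b) (sub_nonneg.2 (hle b w))).1 h0 a (Finset.mem_univ a)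
    have h3 := (mul_eq_zero.1 h2).resolve_left ha.ne'
    linarith
  choose m hm using hS (hz a)
  have hcast : ∀ w, ((∑ i, m i * lapDelete G r w i : ℤ) : ℝ) =
      z a ⬝ᵥ fun i => (lapDelete G r w i : ℝ) := fun w => by
    simp [dotProduct, hm]
  have hone : ∀ w, w ≠ v → ∑ i, m i * lapDelete G r w i = 1 := fun w hw => by
    have := hcast w
    rw [heq w hw] at this
    exact_mod_cast this
  refine ⟨m, fun w => ?_⟩
  split_ifs with hw
  · subst hw
    -- The rows sum to zero, so the value at the remaining row is `-(n - 1)`.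
    have hsum : ∑ w, ∑ i, m i * lapDelete G r w i = 0 := by
      rw [Finset.sum_comm]
      refine Finset.sum_eq_zero fun i _ => ?_
      rw [← Finset.mul_sum]
      have := sum_lapDelete_row_eq_zero G r i
      norm_cast at this
      rw [this, mul_zero]
    rw [← Finset.add_sum_erase _ _ (Finset.mem_univ w),
      Finset.sum_congr rfl fun w' hw' => hone w' (Finset.ne_of_mem_erase hw')] at hsum
    have hpos := Fintype.card_pos_iff.2 ⟨w⟩
    simp [Finset.card_erase_of_mem, Nat.cast_sub (Nat.succ_le_of_lt hpos)] at hsum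
    linarith
  · rw [hone w hw, sub_zero]

/-- If the Laplacian simplex is reflexive and `L_G c` is integral, then `n * c v` is congruent to
the sum of `c` modulo `1` for every vertex `v`. -/
theorem exists_card_mul_eq_sum_sub (hG : G.Connected) {r : V}
    (hrefl : IsReflexive (lapSimplex G r)) {c : V → ℝ}
    (hc : ∀ w, ∃ m : ℤ, (G.lapMatrix ℝ *ᵥ c) w = m) (v : V) :
    ∃ m : ℤ, Fintype.card V * c v = ∑ w, c w - m := by
  obtain ⟨u, hu⟩ := exists_integral_dual_vertex hG hrefl v
  choose m hm using hc
  refine ⟨∑ i, u i * m i, ?_⟩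
  have hu' : ∀ w, ∑ i, (u i : ℝ) * (lapDelete G r w i : ℝ) =
      1 - if w = v then (Fintype.card V : ℝ) else 0 := fun w => by
    have := congrArg (Int.cast : ℤ → ℝ) (hu w)
    simpa only [Int.cast_sum, Int.cast_mul, Int.cast_sub, Int.cast_one, Int.cast_ite,
      Int.cast_natCast, Int.cast_zero] using this
  have : ((∑ i, u i * m i : ℤ) : ℝ) =
      ∑ w, c w * (1 - if w = v then (Fintype.card V : ℝ) else 0) := by
    push_cast
    simp only [← hu', Finset.mul_sum]
    rw [Finset.sum_comm]
    refine Finset.sum_congr rfl fun i _ => ?_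
    rw [← hm, ← sum_mul_lapMatrix_int, Finset.mul_sum]
    exact Finset.sum_congr rfl fun w _ => by
      simp only [lapDelete, Matrix.submatrix_apply, id]
      ring
  rw [this]
  simp [mul_sub, Finset.sum_sub_distrib, mul_comm]

end Laplacian

/-! ### Coefficient vectors of the whiskered graph -/

section Whisker

variable {V : Type*} [Fintype V] [DecidableEq V] {G : SimpleGraph V} [DecidableRel G.Adj]

theorem lapMatrix_whisker_mulVec_inl (c : V ⊕ V → ℝ) (a : V) :
    ((whisker G).lapMatrix ℝ *ᵥ c) (Sum.inl a) =
      (G.lapMatrix ℝ *ᵥ fun v => c (Sum.inl v)) a + (c (Sum.inl a) - c (Sum.inr a)) := by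
  have h1 : ∀ b, (whisker G).Adj (Sum.inl a) (Sum.inl b) ↔ G.Adj a b := fun b => Iff.rfl
  have h2 : ∀ b, (whisker G).Adj (Sum.inl a) (Sum.inr b) ↔ a = b := fun b => Iff.rfl
  simp [lapMatrix_mulVec_eq_sum, h1, h2]

theorem lapMatrix_whisker_mulVec_inr (c : V ⊕ V → ℝ) (a : V) :
    ((whisker G).lapMatrix ℝ *ᵥ c) (Sum.inr a) = c (Sum.inr a) - c (Sum.inl a) := by
  have h1 : ∀ b, (whisker G).Adj (Sum.inr a) (Sum.inl b) ↔ a = b := fun b => Iff.rfl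
  have h2 : ∀ b, ¬(whisker G).Adj (Sum.inr a) (Sum.inr b) := fun b => id
  simp [lapMatrix_mulVec_eq_sum, h1, h2]

theorem eq_zero_of_lapMatrix_whisker_mulVec_eq_zero (hG : G.Connected) {c : V ⊕ V → ℝ}
    (hc : (whisker G).lapMatrix ℝ *ᵥ c = 0) (hs : ∑ v, c v = 0) : c = 0 := by
  have hr : ∀ a, c (Sum.inr a) = c (Sum.inl a) := fun a => by
    have := congrFun hc (Sum.inr a)
    rw [lapMatrix_whisker_mulVec_inr] at this
    exact sub_eq_zero.1 this
  have hl : (fun v => c (Sum.inl v)) = 0 := by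
    refine eq_zero_of_lapMatrix_mulVec_eq_zero hG ?_ ?_
    · ext a
      have := congrFun hc (Sum.inl a)
      rwa [lapMatrix_whisker_mulVec_inl, hr, sub_self, add_zero] at this
    · rw [Fintype.sum_sum_type] at hs
      simp only [hr] at hs
      linarith
  ext (a | a)
  · exact congrFun hl a
  · rw [hr]
    exact congrFun hl a

/-- A coefficient vector of the whiskered graph takes equal values at a vertex and at its
whisker. -/
theorem mem_parCoeffs_whisker_iff (s : V ⊕ V) (c : V ⊕ V → ℝ) :
    c ∈ parCoeffs (lapDelete (whisker G) s) ↔ ∃ a : V → ℝ, c = Sum.elim a a ∧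
      (∀ v, 0 ≤ a v ∧ a v < 1) ∧ (∀ w, ∃ m : ℤ, (G.lapMatrix ℝ *ᵥ a) w = m) ∧
      ∃ m : ℤ, 2 * ∑ v, a v = m := by
  rw [mem_parCoeffs_lapDelete_iff]
  constructor
  · rintro ⟨hc, hL, hs⟩
    have hr : ∀ a, c (Sum.inr a) = c (Sum.inl a) := fun a => by
      obtain ⟨m, hm⟩ := hL (Sum.inr a)
      rw [lapMatrix_whisker_mulVec_inr] at hm
      have h1 : (m : ℝ) < 1 := by linarith [(hc (Sum.inr a)).2, (hc (Sum.inl a)).1]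
      have h2 : (-1 : ℝ) < m := by linarith [(hc (Sum.inr a)).1, (hc (Sum.inl a)).2]
      have h3 : m = 0 := by
        norm_cast at h1 h2
        have h2 : -1 < m := by exact_mod_cast h2
        omega
      rw [h3, Int.cast_zero] at hm
      linarith
    refine ⟨fun v => c (Sum.inl v), ?_, fun v => hc _, fun w => ?_, ?_⟩
    · ext (a | a)
      · rfl
      · exact hr a
    · obtain ⟨m, hm⟩ := hL (Sum.inl w)
      rw [lapMatrix_whisker_mulVec_inl, hr, sub_self, add_zero] at hm
      exact ⟨m, hm⟩
    · obtain ⟨m, hm⟩ := hs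
      rw [Fintype.sum_sum_type] at hm
      simp only [hr] at hm
      exact ⟨m, by linarith⟩
  · rintro ⟨a, rfl, ha, hL, m, hm⟩
    refine ⟨Sum.rec ha ha, Sum.rec (fun w => ?_) fun w => ⟨0, ?_⟩, m, ?_⟩
    · rw [Fintype.sum_sum_type, ← hm]
      simp only [Sum.elim_inl, Sum.elim_inr]
      ring
    · rw [lapMatrix_whisker_mulVec_inl]
      simpa using hL w
    · rw [lapMatrix_whisker_mulVec_inr]
      simp

theorem lapMatrix_mulVec_add_const (a : V → ℝ) (t : ℝ) :
    G.lapMatrix ℝ *ᵥ (a + fun _ => t) = G.lapMatrix ℝ *ᵥ a := by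
  have : (fun _ : V => t) = t • fun _ => (1 : ℝ) := by
    ext
    simp
  rw [Matrix.mulVec_add, this, Matrix.mulVec_smul, G.lapMatrix_mulVec_const_eq_zero, smul_zero,
    add_zero]

theorem parCoeffs_whisker (hG : G.Connected) {r : V} (hrefl : IsReflexive (lapSimplex G r))
    (s : V ⊕ V) :
    parCoeffs (lapDelete (whisker G) s) =
      (fun l => Sum.elim l l) '' parCoeffs (lapDelete G r) ∪
      (fun l => Sum.elim l l + fun _ => 1 / (2 * (Fintype.card V : ℝ))) ''
        parCoeffs (lapDelete G r) := by
  have hcard : 0 < Fintype.card V := Fintype.card_pos_iff.2 ⟨r⟩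
  have hn : (0 : ℝ) < Fintype.card V := by exact_mod_cast hcard
  set t : ℝ := 1 / (2 * (Fintype.card V : ℝ)) with ht
  have htn : Fintype.card V * t = 1 / 2 := by
    rw [ht]
    field_simp
  have htpos : 0 < t := by positivity
  have hsum : ∀ a : V → ℝ, ∑ v, (a v + t) = ∑ v, a v + 1 / 2 := fun a => by
    simp [Finset.sum_add_distrib, ← htn]
  ext c
  rw [mem_parCoeffs_whisker_iff, Set.mem_union, Set.mem_image, Set.mem_image]
  constructor
  · rintro ⟨a, rfl, ha, hL, m, hm⟩
    rcases Int.even_or_odd' m with ⟨k, rfl | rfl⟩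
    · left
      refine ⟨a, (mem_parCoeffs_lapDelete_iff G r a).2 ⟨ha, hL, k, ?_⟩, rfl⟩
      push_cast at hm
      linarith
    · right
      push_cast at hm
      refine ⟨fun v => a v - t,
        (mem_parCoeffs_lapDelete_iff G r _).2 ⟨fun v => ⟨?_, ?_⟩, ?_, k, ?_⟩, ?_⟩
      -- Here `n * a v = k - j + 1/2` is nonnegative, hence at least `1/2 = n * t`.
      · obtain ⟨j, hj⟩ := exists_card_mul_eq_sum_sub hG hrefl hL v
        have h0 : (0 : ℝ) ≤ Fintype.card V * a v := mul_nonneg hn.le (ha v).1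
        have h1 : (0 : ℝ) ≤ 2 * (k - j : ℤ) + 1 := by
          push_cast
          linarith
        have h2 : 0 ≤ k - j := by
          have : (0 : ℤ) ≤ 2 * (k - j) + 1 := by exact_mod_cast h1
          omega
        have h3 : (0 : ℝ) ≤ (k - j : ℤ) := by exact_mod_cast h2
        push_cast at h3
        have h4 : Fintype.card V * t ≤ Fintype.card V * a v := by linarith
        linarith [le_of_mul_le_mul_left h4 hn]
      · linarith [(ha v).2]
      · have : (fun v => a v - t) + (fun _ => t) = a := by
          ext v
          simp
        intro w
        rw [← lapMatrix_mulVec_add_const _ t, this]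
        exact hL w
      · have := hsum fun v => a v - t
        simp only [sub_add_cancel] at this
        linarith
      · ext (v | v) <;> simp
  · rintro (⟨l, hl, rfl⟩ | ⟨l, hl, rfl⟩)
    · obtain ⟨hl, hL, m, hm⟩ := (mem_parCoeffs_lapDelete_iff G r l).1 hl
      exact ⟨l, rfl, hl, hL, 2 * m, by rw [hm]; push_cast; rfl⟩
    · obtain ⟨hl, hL, m, hm⟩ := (mem_parCoeffs_lapDelete_iff G r l).1 hl
      refine ⟨l + fun _ => t, ?_, fun v => ⟨add_nonneg (hl v).1 htpos.le, ?_⟩, fun w => ?_,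
        2 * m + 1, ?_⟩
      · ext (v | v) <;> rfl
      -- Here `n * l v = m - j` is an integer below `n`, hence at most `n - 1`, and adding `n * t =
      -- 1/2` stays below `n`.
      · obtain ⟨j, hj⟩ := exists_card_mul_eq_sum_sub hG hrefl hL v
        have h0 : (Fintype.card V : ℝ) * l v < Fintype.card V := by
          simpa using mul_lt_mul_of_pos_left (hl v).2 hn
        have h1 : ((m - j : ℤ) : ℝ) < (Fintype.card V : ℤ) := by
          push_cast
          linarith
        have h2 : m - j + 1 ≤ (Fintype.card V : ℤ) := by exact_mod_cast h1
        have h3 : ((m - j + 1 : ℤ) : ℝ) ≤ (Fintype.card V : ℤ) := by exact_mod_cast h2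
        push_cast at h3
        have h4 : Fintype.card V * (l v + t) < Fintype.card V * 1 := by
          rw [mul_add]
          linarith
        exact lt_of_mul_lt_mul_left h4 hn.le
      · rw [lapMatrix_mulVec_add_const]
        exact hL w
      · have := hsum l
        simp only [Pi.add_apply]
        push_cast
        linarith

theorem parPolynomial_whisker (hG : G.Connected) {r : V} (hrefl : IsReflexive (lapSimplex G r))
    (s : V ⊕ V) :
    parPolynomial (lapDelete (whisker G) s) =
      (1 + Polynomial.X) * (parPolynomial (lapDelete G r)).comp (Polynomial.X ^ 2) := by
  have hcard : 0 < Fintype.card V := Fintype.card_pos_iff.2 ⟨r⟩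
  have hn : (Fintype.card V : ℝ) ≠ 0 := by positivity
  have hfin : (parCoeffs (lapDelete G r)).Finite := finite_parCoeffs _ <|
    injective_vecMul_lapDelete G r fun c hc hs => eq_zero_of_lapMatrix_mulVec_eq_zero hG hc hs
  have hinj : Function.Injective fun l : V → ℝ => Sum.elim l l := fun a b h => by
    ext v
    exact congrFun h (Sum.inl v)
  have hinj' : Function.Injective fun l : V → ℝ =>
      (Sum.elim l l + fun _ => 1 / (2 * (Fintype.card V : ℝ)) : V ⊕ V → ℝ) :=
    fun a b h => hinj (add_right_cancel h)
  have hsum : ∀ l ∈ parCoeffs (lapDelete G r),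
      ∑ v, Sum.elim l l v = ((2 * ⌊∑ v, l v⌋₊ : ℕ) : ℝ) := fun l hl => by
    rw [Fintype.sum_sum_type]
    simp only [Sum.elim_inl, Sum.elim_inr]
    rw [sum_eq_floor_of_mem_parCoeffs hl, Nat.floor_natCast]
    push_cast
    ring
  have hsum' : ∀ l ∈ parCoeffs (lapDelete G r),
      ∑ v, (Sum.elim l l + fun _ => 1 / (2 * (Fintype.card V : ℝ)) : V ⊕ V → ℝ) v =
        ((2 * ⌊∑ v, l v⌋₊ + 1 : ℕ) : ℝ) := fun l hl => by
    simp only [Pi.add_apply]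
    rw [Finset.sum_add_distrib, hsum l hl, Finset.sum_const, Finset.card_univ, Fintype.card_sum]
    push_cast
    rw [nsmul_eq_mul]
    push_cast
    field_simp
    ring
  rw [parPolynomial, parCoeffs_whisker hG hrefl, finsum_mem_union _ (hfin.image _) (hfin.image _),
    finsum_mem_image hinj.injOn, finsum_mem_image hinj'.injOn, parPolynomial, add_mul, one_mul,
    ← Polynomial.coe_compRingHom_apply, finsum_mem_eq_finite_toFinset_sum _ hfin,
    finsum_mem_eq_finite_toFinset_sum _ hfin, finsum_mem_eq_finite_toFinset_sum _ hfin, map_sum,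
    Finset.mul_sum]
  · congr 1
    · refine Finset.sum_congr rfl fun l hl => ?_
      rw [hsum l (hfin.mem_toFinset.1 hl), Nat.floor_natCast]
      simp [pow_mul]
    · refine Finset.sum_congr rfl fun l hl => ?_
      rw [hsum' l (hfin.mem_toFinset.1 hl), Nat.floor_natCast]
      simp [pow_mul, pow_succ']
  -- The two families have heights of opposite parity.
  · rw [Set.disjoint_left]
    rintro _ ⟨l, hl, rfl⟩ ⟨l', hl', h⟩
    have h1 := hsum' l' hl'
    simp only at h
    rw [h, hsum l hl] at h1
    norm_cast at h1
    omega

end Whisker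

/-! ### Unimodality and the main theorem -/

theorem isUnimodal_one_add_X_mul_comp_iff (p : ℤ[X]) (d : ℕ) :
    IsUnimodal (2 * d + 1) ((1 + Polynomial.X) * p.comp (Polynomial.X ^ 2)).coeff ↔
      IsUnimodal d p.coeff := by
  set q := (1 + Polynomial.X) * p.comp (Polynomial.X ^ 2) with hq
  have hexp : p.comp (Polynomial.X ^ 2) = Polynomial.expand ℤ 2 p :=
    (Polynomial.expand_eq_comp_X_pow 2).symm
  have he : ∀ i, q.coeff (2 * i) = p.coeff i := fun i => by
    rw [hq, add_mul, one_mul, Polynomial.coeff_add, hexp, Polynomial.coeff_expand_mul' two_pos]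
    rcases i with _ | i
    · simp
    · rw [show 2 * (i + 1) = 2 * i + 1 + 1 by ring, Polynomial.coeff_X_mul,
        Polynomial.coeff_expand two_pos, if_neg (by omega), add_zero]
  have ho : ∀ i, q.coeff (2 * i + 1) = p.coeff i := fun i => by
    rw [hq, add_mul, one_mul, Polynomial.coeff_add, hexp, Polynomial.coeff_X_mul,
      Polynomial.coeff_expand_mul' two_pos, Polynomial.coeff_expand two_pos, if_neg (by omega),
      zero_add]
  constructor
  · rintro ⟨j, hj, hup, hdown⟩
    -- Only the steps from `2 * i + 1` to `2 * i + 2` compare distinct coefficients of `p`; rounding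
    -- `j / 2` down puts them on the correct side of the peak.
    refine ⟨j / 2, by omega, fun i hi => ?_, fun k hk hkd => ?_⟩
    · have := hup (2 * i + 1) (by omega)
      rwa [ho, show 2 * i + 1 + 1 = 2 * (i + 1) by ring, he] at this
    · have := hdown (2 * k + 1) (by omega) (by omega)
      rwa [ho, show 2 * k + 1 + 1 = 2 * (k + 1) by ring, he] at this
  · rintro ⟨j, hj, hup, hdown⟩
    refine ⟨2 * j, by omega, fun i hi => ?_, fun k hk hkd => ?_⟩
    · rcases Nat.even_or_odd' i with ⟨i, rfl | rfl⟩
      · rw [he, ho]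
      · rw [ho, show 2 * i + 1 + 1 = 2 * (i + 1) by ring, he]
        exact hup i (by omega)
    · rcases Nat.even_or_odd' k with ⟨k, rfl | rfl⟩
      · rw [he, ho]
      · rw [ho, show 2 * k + 1 + 1 = 2 * (k + 1) by ring, he]
        exact hdown k (by omega) (by omega)

end LaplacianSimplex

theorem mainTheorem9 {V : Type*} [Fintype V] [DecidableEq V]
    (G : SimpleGraph V) [DecidableRel G.Adj] (hG : G.Connected) (r : V)
    (hrefl : IsReflexive (lapSimplex G r)) (s : V ⊕ V) :
    -- the lattice points of the fundamental parallelepiped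
    (fundPar (lapDelete (whisker G) s) ∩ intPoints ({w : V ⊕ V // w ≠ s} ⊕ Unit) =
      {x | ∃ l ∈ parCoeffs (lapDelete G r),
        x = Sum.elim l l ᵥ* appendOne (lapDelete (whisker G) s) ∨
        x = (Sum.elim l l + fun _ => 1 / (2 * (Fintype.card V : ℝ))) ᵥ*
          appendOne (lapDelete (whisker G) s)}) ∧
    -- the two polynomials, their relation, and unimodality
    ∃ hstarG hstarW : ℤ[X],
      IsHStarPolynomial (lapSimplex G r) hstarG ∧
      IsHStarPolynomial (lapSimplex (whisker G) s) hstarW ∧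
      hstarW = (1 + Polynomial.X) * hstarG.comp (Polynomial.X ^ 2) ∧
      (IsUnimodal (polyDim (lapSimplex (whisker G) s)) hstarW.coeff ↔
        IsUnimodal (polyDim (lapSimplex G r)) hstarG.coeff) := by
  have : Nonempty V := ⟨r⟩
  have hinj := injective_vecMul_lapDelete G r
    fun c hc hs => eq_zero_of_lapMatrix_mulVec_eq_zero hG hc hs
  have hinjW := injective_vecMul_lapDelete (whisker G) s
    fun c hc hs => eq_zero_of_lapMatrix_whisker_mulVec_eq_zero hG hc hs
  refine ⟨?_, parPolynomial (lapDelete G r), parPolynomial (lapDelete (whisker G) s),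
    isHStarPolynomial_rowHull hinj, isHStarPolynomial_rowHull hinjW,
    parPolynomial_whisker hG hrefl s, ?_⟩
  · rw [fundPar_inter_intPoints, parCoeffs_whisker hG hrefl s, Set.image_union, Set.image_image,
      Set.image_image]
    ext x
    simp only [Set.mem_union, Set.mem_image, Set.mem_ofPred_eq, eq_comm (b := x), ← exists_or,
      ← and_or_left]
  · have hd := polyDim_rowHull_add_one _ hinj
    have hdW := polyDim_rowHull_add_one _ hinjW
    rw [Fintype.card_sum] at hdW
    -- The dimensions are `n - 1` and `2n - 1`.
    have hdim : polyDim (lapSimplex (whisker G) s) = 2 * polyDim (lapSimplex G r) + 1 := by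
      unfold lapSimplex
      omega
    rw [hdim, parPolynomial_whisker hG hrefl s, isUnimodal_one_add_X_mul_comp_iff]
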